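/- Let $m\ge 0$ be an integer and let $\mathcal{G}$ be a finite collection of colored chains: each member of $\mathcal{G}$ is a finite sequence $(i_1\prec i_2\prec\cdots\prec i_\ell)$ of colors $i_j\in\{1,\ldots,m\}$ with $\ell\ge 2$. A colored subset of $\mathcal{P}([n])$ is a set $S\subseteq\mathcal{P}([n])$ together with a coloring $c:S\to\{1,\ldots,m\}$; it is valid if there are no $(i_1\prec\cdots\prec i_\ell)\in\mathcal{G}$ and $x_1\subsetneq\cdots\subsetneq x_\ell$ in $S$ with $c(x_j)=i_j$ for all $1\le j\le\ell$. Let $\Lambda(\mathcal{G},n)$ be the set of valid colored subsets of $\mathcal{P}([n])$. A template is a function $T:\mathcal{P}([n])\to\mathcal{P}(\{1,\ldots,m\})$; its support is $\mathrm{Supp}(T)=\{x : T(x)\ne\emptyset\}$, and its weight is $\omega(T)=\sum_{x\in\mathcal{P}([n])}\log(1+|T(x)|)$. It is valid if every coloring $c$ of $\mathrm{Supp}(T)$ with $c(x)\in T(x)$ for all $x\in\mathrm{Supp}(T)$ is valid, and it is supported on $A\subseteq\mathcal{P}([n])$ if $\mathrm{Supp}(T)\subseteq A$. Theorem. Suppose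 that $\mathcal{G}$ is sparse, that is, for every color $i\in\{1,\ldots,m\}$ it contains a chain all of whose elements have color $i$. Then the maximum $$\omega_{crit}=\max\{\omega(T) : T \text{ a valid template on } \mathcal{P}([r]) \text{ for some } r\ge 0, \text{ supported on a chain of } \mathcal{P}([r])\}$$ exists (it is a constant that depends only on $\mathcal{G}$ and $m$), and as $n\to\infty$ $$|\Lambda(\mathcal{G},n)| = e^{\omega_{crit}\binom{n}{\lfloor n/2\rfloor}(1+o(1))}.$$ -/

import Mathlib

namespace ColoredChains

/-- A colored subset of `P` with colors `Fin m`: a subset `S` of `P` together with a map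
`S → Fin m`, encoded as `c : P → Option (Fin m)`, where `c x = none` means `x ∉ S` and
`c x = some i` means that `x ∈ S` has color `i`. -/
abbrev ColoredSubset (P : Type*) (m : ℕ) := P → Option (Fin m)

/-- A colored chain poset `i₁ ≺ i₂ ≺ ⋯ ≺ i_ℓ` is the list `[i₁, …, i_ℓ]` of its colors, from
bottom to top.  It appears in a colored subset if there are `x₁ < x₂ < ⋯ < x_ℓ` such that
each `x_j` belongs to the colored subset and has color `i_j`. -/
def Appears {P : Type*} [PartialOrder P] {m : ℕ} (g : List (Fin m)) (c : ColoredSubset P m) :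
    Prop :=
  ∃ x : Fin g.length → P, StrictMono x ∧ ∀ j, c (x j) = some (g.get j)

/-- A colored subset is valid with respect to `G` if no member of `G` appears in it. -/
def IsValid {P : Type*} [PartialOrder P] {m : ℕ} (G : Finset (List (Fin m)))
    (c : ColoredSubset P m) : Prop :=
  ∀ g ∈ G, ¬ Appears g c

/-- The collection of validly colored subsets of the Boolean lattice on `n` points. -/
def Lam {m : ℕ} (G : Finset (List (Fin m))) (n : ℕ) :
    Set (ColoredSubset (Finset (Fin n)) m) :=
  {c | IsValid G c}

/-- A template on the Boolean lattice assigns to every set a set of colors. -/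
abbrev Template (n m : ℕ) := Finset (Fin n) → Finset (Fin m)

namespace Template

variable {n m : ℕ}

/-- `T` is supported on `A` if `T x = ∅` for all `x ∉ A`. -/
def SupportedOn (T : Template n m) (A : Set (Finset (Fin n))) : Prop :=
  ∀ x, x ∉ A → T x = ∅

/-- The smallest set on which `T` is supported. -/
def Supp (T : Template n m) : Set (Finset (Fin n)) :=
  {x | T x ≠ ∅}

/-- `c` is a coloring of exactly the set `Supp T`, with the color of each `x` taken from `T x`. -/
def IsColoring (T : Template n m) (c : ColoredSubset (Finset (Fin n)) m) : Prop :=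
  (∀ x ∈ T.Supp, ∃ i ∈ T x, c x = some i) ∧ ∀ x ∉ T.Supp, c x = none

/-- A template is valid if all colorings of its support taken from it are valid. -/
def Valid (G : Finset (List (Fin m))) (T : Template n m) : Prop :=
  ∀ c, T.IsColoring c → IsValid G c

/-- The weight of a template. -/
noncomputable def omega (T : Template n m) : ℝ :=
  ∑ x, Real.log (1 + ((T x).card : ℝ))

end Template

/-- The weights of all valid templates, on Boolean lattices of any size, that are supported on
a chain. -/
def critWeights {m : ℕ} (G : Finset (List (Fin m))) : Set ℝ :=
  {w | ∃ (n : ℕ) (T : Template n m) (A : Set (Finset (Fin n))),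
    T.Valid G ∧ IsChain (· ⊆ ·) A ∧ T.SupportedOn A ∧ w = T.omega}

/-- `G` is sparse: it contains a monochromatic chain of every color. -/
def IsSparse {m : ℕ} (G : Finset (List (Fin m))) : Prop :=
  ∀ i : Fin m, ∃ g ∈ G, ∀ j ∈ g, j = i

/-- The critical weight, the largest element of `critWeights G`. -/
noncomputable def omegaCrit {m : ℕ} (G : Finset (List (Fin m))) : ℝ :=
  sSup (critWeights G)

end ColoredChains

/-! Along a chain, sparsity bounds how often each color may be allowed, so weights of valid
templates on chains take finitely many values and the maximum exists.

Lower bound: copy the layers of an optimal chain template to consecutive layers of the n-cube from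
the middle upwards (`exp_omega_spread_le_ncard_Lam`). Each fixed number of steps above the middle, a
layer has size asymptotic to the middle one.

Upper bound: a container argument. In a valid coloring `c`, pick a largest partial coloring `F`
whose potential, a weighted count of suffixes of members of `G` visible above sets, is at least `δ`
per colored set. Boundedness of the potential makes `F` small, O(2^n / n) for fixed `δ`, so there
are exp(O(2^n log n / n)) choices, negligible since the middle binomial coefficient has order 2^n /
√n. Maximality of `F` puts `c` inside a template determined by `F` alone (`exists_fingerprint`).

The container is weighed by averaging over maximal chains, encoded as numberings. Cutting such a
chain at each member that makes a new suffix visible to a smaller member leaves pieces on which the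
container is valid, of weight at most `omegaCrit G` each (`sum_log_isPrefix_le`). Cuts are rare
(`sum_card_badPrefixes_le`), so the weight is at most (1 + O(δ)) `omegaCrit G` times the middle
binomial coefficient (`omega_container_mul_le`). Finally n tends to infinity and `δ` to 0. -/

open Finset

namespace ColoredChains

/-! ### Occurrences of colored chains, built from the bottom element upwards -/

section Occurs

variable {P : Type*} [PartialOrder P] {m : ℕ}

/-- The colored chain `g` occurs in the relation `R` if there are `x₁ < ⋯ < x_ℓ` such that each
`x_j` is related to the `j`-th color of `g`. -/
def Occurs (R : P → Fin m → Prop) (g : List (Fin m)) : Prop :=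
  ∃ x : Fin g.length → P, StrictMono x ∧ ∀ j, R (x j) (g.get j)

/-- The colored chain `p` occurs in the relation `R` strictly above `x`. -/
def ReachAbove (R : P → Fin m → Prop) : List (Fin m) → P → Prop
  | [], _ => True
  | i :: p, x => ∃ z, x < z ∧ R z i ∧ ReachAbove R p z

lemma reachAbove_iff (R : P → Fin m → Prop) (p : List (Fin m)) (x : P) :
    ReachAbove R p x ↔
      ∃ y : Fin p.length → P, StrictMono y ∧ (∀ j, x < y j) ∧ ∀ j, R (y j) (p.get j) := by
  induction p generalizing x with
  | nil => exact ⟨fun _ => ⟨fun j => j.elim0, fun j => j.elim0, fun j => j.elim0, fun j => j.elim0⟩,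
      fun _ => trivial⟩
  | cons i p ih =>
    constructor
    · rintro ⟨z, hxz, hz, h⟩
      obtain ⟨y, hy, hzy, hR⟩ := (ih z).1 h
      refine ⟨(Fin.cons z y : Fin (p.length + 1) → P), Fin.strictMono_cons.2 ⟨hzy, hy⟩,
        fun j => ?_, fun j => ?_⟩
      · refine Fin.cases ?_ (fun j => ?_) j
        · exact hxz
        · exact hxz.trans (hzy j)
      · refine Fin.cases ?_ (fun j => ?_) j
        · exact hz
        · exact hR j
    · rintro ⟨y, hy, hxy, hR⟩
      change Fin (p.length + 1) → P at y
      refine ⟨y 0, hxy 0, hR 0, (ih _).2 ⟨fun j => y j.succ, fun a b hab => hy ?_, fun j => hy ?_,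
        fun j => hR j.succ⟩⟩
      · exact Fin.succ_lt_succ_iff.2 hab
      · exact Fin.succ_pos j

lemma occurs_cons_iff (R : P → Fin m → Prop) (i : Fin m) (p : List (Fin m)) :
    Occurs R (i :: p) ↔ ∃ z, R z i ∧ ReachAbove R p z := by
  constructor
  · rintro ⟨y, hy, hR⟩
    change Fin (p.length + 1) → P at y
    refine ⟨y 0, hR 0, (reachAbove_iff _ _ _).2 ⟨fun j => y j.succ, fun a b hab => hy ?_,
      fun j => hy ?_, fun j => hR j.succ⟩⟩
    · exact Fin.succ_lt_succ_iff.2 hab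
    · exact Fin.succ_pos j
  · rintro ⟨z, hz, h⟩
    obtain ⟨y, hy, hzy, hR⟩ := (reachAbove_iff _ _ _).1 h
    refine ⟨(Fin.cons z y : Fin (p.length + 1) → P), Fin.strictMono_cons.2 ⟨hzy, hy⟩,
      fun j => ?_⟩
    refine Fin.cases ?_ (fun j => ?_) j
    · exact hz
    · exact hR j

/-- Visibility grows with the relation and passes down to smaller sets; both the cutting argument
and the potential rest on this. -/
lemma ReachAbove.mono {R R' : P → Fin m → Prop} (hR : ∀ x i, R x i → R' x i)
    {p : List (Fin m)} {x y : P} (hyx : y ≤ x) (h : ReachAbove R p x) : ReachAbove R' p y := by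
  induction p generalizing x y with
  | nil => trivial
  | cons i p ih =>
    obtain ⟨z, hxz, hz, h⟩ := h
    exact ⟨z, hyx.trans_lt hxz, hR _ _ hz, ih le_rfl h⟩

end Occurs

/-! ### Validity of templates and chains of sets -/

namespace Template

variable {n m : ℕ}

/-- The members of a strict chain are distinct, so their colors can be chosen independently and
extended to a coloring of the whole support. -/
lemma valid_iff (G : Finset (List (Fin m))) (T : Template n m) :
    T.Valid G ↔ ∀ g ∈ G, ¬ Occurs (fun x i => i ∈ T x) g := by
  classical
  constructor
  · rintro hT g hg ⟨x, hx, hxT⟩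
    let c : ColoredSubset (Finset (Fin n)) m := fun y =>
      if h : ∃ j, x j = y then some (g.get h.choose)
      else if h : (T y).Nonempty then some h.choose else none
    have hcx : ∀ j, c (x j) = some (g.get j) := by
      intro j
      have h : ∃ j', x j' = x j := ⟨j, rfl⟩
      simp only [c, dif_pos h]
      rw [hx.injective h.choose_spec]
    refine hT c ⟨fun y hy => ?_, fun y hy => ?_⟩ g hg ⟨x, hx, hcx⟩
    · by_cases h : ∃ j, x j = y
      · obtain ⟨j, rfl⟩ := h
        exact ⟨_, hxT j, hcx j⟩
      · have h' : (T y).Nonempty := nonempty_iff_ne_empty.2 hy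
        exact ⟨h'.choose, h'.choose_spec, by simp only [c, dif_neg h, dif_pos h']⟩
    · have hy' : T y = ∅ := by simpa [Supp] using hy
      have h : ¬ ∃ j, x j = y := by
        rintro ⟨j, rfl⟩
        have := hxT j
        simp [hy'] at this
      simp [c, dif_neg h, hy']
  · rintro hT c hc g hg ⟨x, hx, hcx⟩
    refine hT g hg ⟨x, hx, fun j => ?_⟩
    by_cases h : x j ∈ T.Supp
    · obtain ⟨i, hi, hi'⟩ := hc.1 _ h
      rw [hcx j] at hi'
      rw [Option.some.inj hi']
      exact hi
    · have := hc.2 _ h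
      rw [hcx j] at this
      cases this

lemma omega_eq_sum_range (T : Template n m) :
    T.omega = ∑ j ∈ range (m + 1), (#{x | #(T x) = j} : ℝ) * Real.log (1 + j) := by
  rw [omega, ← sum_fiberwise_of_maps_to (s := univ) (t := range (m + 1)) (g := fun x => #(T x))]
  · refine sum_congr rfl fun j _ => ?_
    rw [sum_congr rfl (g := fun _ => Real.log (1 + (j : ℝ)))]
    · simp
    · intro x hx
      simp only [mem_filter, mem_univ, true_and] at hx
      rw [hx]
  · intro x _
    simpa [Nat.lt_succ_iff] using card_le_univ (T x)

end Template

lemma isChain_lt_of_card_lt {α : Type*} {A : Set (Finset α)} (hA : IsChain (· ⊆ ·) A)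
    {x y : Finset α} (hx : x ∈ A) (hy : y ∈ A) (h : #x < #y) : x < y := by
  rcases hA.total hx hy with h' | h'
  · exact h'.ssubset_of_ne (by rintro rfl; exact lt_irrefl _ h)
  · exact absurd (card_le_card h') (not_le.2 h)

lemma isChain_eq_of_card_eq {α : Type*} {A : Set (Finset α)} (hA : IsChain (· ⊆ ·) A)
    {x y : Finset α} (hx : x ∈ A) (hy : y ∈ A) (h : #x = #y) : x = y := by
  rcases hA.total hx hy with h' | h'
  · exact eq_of_subset_of_card_le h' h.ge
  · exact (eq_of_subset_of_card_le h' h.le).symm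

lemma exists_strictMono_of_isChain {α : Type*} {B : Finset (Finset α)}
    (hB : IsChain (· ⊆ ·) (B : Set (Finset α))) {ℓ : ℕ} (h : ℓ ≤ #B) :
    ∃ x : Fin ℓ → Finset α, StrictMono x ∧ ∀ j, x j ∈ B := by
  classical
  have hinj : Set.InjOn card (B : Set (Finset α)) :=
    fun x hx y hy hxy => isChain_eq_of_card_eq hB hx hy hxy
  have hcard : ℓ ≤ #(B.image card) := by rwa [card_image_of_injOn hinj]
  let e := (B.image card).orderEmbOfCardLe hcard
  have he : ∀ j, ∃ x ∈ B, #x = e j := fun j =>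
    mem_image.1 ((B.image card).orderEmbOfCardLe_mem hcard j)
  choose x hxB hx using he
  refine ⟨x, fun a b hab => isChain_lt_of_card_lt hB (hxB a) (hxB b) ?_, hxB⟩
  rw [hx, hx]
  exact e.strictMono hab

/-! ### Existence of the critical weight -/

section Crit

variable {m : ℕ} {G : Finset (List (Fin m))}

lemma exists_card_support_le (hG : IsSparse G) : ∃ K : ℕ, ∀ (n : ℕ) (T : Template n m)
    (A : Set (Finset (Fin n))), T.Valid G → IsChain (· ⊆ ·) A → T.SupportedOn A →
    #{x | T x ≠ ∅} ≤ K := by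
  classical
  choose g hg hgi using hG
  -- On a chain, color `i` cannot be allowed at as many sets as its monochromatic member of `G` has
  -- elements.
  refine ⟨∑ i, (g i).length, fun n T A hT hA hTA => ?_⟩
  rw [Template.valid_iff] at hT
  have hsub : ({x | T x ≠ ∅} : Finset (Finset (Fin n))) ⊆
      univ.biUnion fun i : Fin m => ({x | i ∈ T x} : Finset (Finset (Fin n))) := by
    intro x hx
    simp only [mem_filter, mem_univ, true_and] at hx
    obtain ⟨i, hi⟩ := nonempty_iff_ne_empty.2 hx
    simp only [mem_biUnion, mem_univ, true_and, mem_filter]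
    exact ⟨i, hi⟩
  refine (card_le_card hsub).trans (card_biUnion_le.trans (sum_le_sum fun i _ => ?_))
  by_contra! hlt
  have hB : IsChain (· ⊆ ·)
      (↑({x | i ∈ T x} : Finset (Finset (Fin n))) : Set (Finset (Fin n))) := by
    refine hA.mono fun x hx => ?_
    by_contra hxA
    simp [hTA x hxA] at hx
  obtain ⟨x, hx, hxB⟩ := exists_strictMono_of_isChain hB hlt.le
  refine hT _ (hg i) ⟨x, hx, fun j => ?_⟩
  have := hxB j
  rw [hgi i _ ((g i).get_mem j)]
  simpa using this

lemma critWeights_finite (hG : IsSparse G) : (critWeights G).Finite := by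
  obtain ⟨K, hK⟩ := exists_card_support_le hG
  refine ((Set.finite_Iic fun _ : Fin (m + 1) => K).image fun v =>
    ∑ j : Fin (m + 1), (v j : ℝ) * Real.log (1 + (j : ℕ))).subset ?_
  rintro w ⟨n, T, A, hT, hA, hTA, rfl⟩
  -- The number of sets without colors is unbounded in `n`, but its coefficient is log 1 = 0, so it
  -- is replaced by 0.
  refine ⟨fun j => if (j : ℕ) = 0 then 0 else #{x | #(T x) = j}, fun j => ?_, ?_⟩
  · by_cases hj : (j : ℕ) = 0
    · simp [hj]
    · simp only [hj, if_false]
      refine (card_le_card fun x hx => ?_).trans (hK n T A hT hA hTA)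
      simp only [mem_filter, mem_univ, true_and] at hx ⊢
      rintro h
      simp [h] at hx
      exact hj hx.symm
  · rw [Template.omega_eq_sum_range, ← Fin.sum_univ_eq_sum_range
      (fun j => (#{x | #(T x) = j} : ℝ) * Real.log (1 + j))]
    refine sum_congr rfl fun j _ => ?_
    by_cases hj : (j : ℕ) = 0 <;> simp [hj]

lemma mem_critWeights_of_occurs {n : ℕ} {T : Template n m} {A : Set (Finset (Fin n))}
    (hT : ∀ g ∈ G, ¬ Occurs (fun x i => i ∈ T x) g) (hA : IsChain (· ⊆ ·) A)
    (hTA : T.SupportedOn A) : T.omega ∈ critWeights G :=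
  ⟨n, T, A, (Template.valid_iff G T).2 hT, hA, hTA, rfl⟩

/-- The lattice on 0 points has one element, so no chain of two elements forbids allowing all colors
there. -/
lemma log_one_add_mem_critWeights (hlen : ∀ g ∈ G, 2 ≤ g.length) :
    Real.log (1 + m) ∈ critWeights G := by
  have h := mem_critWeights_of_occurs (G := G) (n := 0) (T := fun _ => univ) (A := Set.univ)
    ?_ ?_ ?_
  · simpa [Template.omega] using h
  · rintro g hg ⟨x, hx, -⟩
    have := hlen g hg
    exact (hx (show (⟨0, by omega⟩ : Fin g.length) < ⟨1, by omega⟩ by simp)).ne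
      (Subsingleton.elim _ _)
  · intro x _ y _ hxy
    exact absurd (Subsingleton.elim x y) hxy
  · intro x hx
    exact absurd (Set.mem_univ x) hx

lemma isGreatest_omegaCrit (hlen : ∀ g ∈ G, 2 ≤ g.length) (hG : IsSparse G) :
    IsGreatest (critWeights G) (omegaCrit G) := by
  have hne : (critWeights G).Nonempty := ⟨_, log_one_add_mem_critWeights hlen⟩
  exact ⟨hne.csSup_mem (critWeights_finite hG),
    fun w hw => le_csSup (critWeights_finite hG).bddAbove hw⟩

end Crit

/-! ### Maximal chains as prefixes of numberings -/

section Numbering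

variable {n : ℕ}

lemma sum_sum_isPrefix (a : Finset (Fin n) → ℝ) :
    ∑ f : Numbering (Fin n), ∑ x with f.IsPrefix x, a x =
      ∑ x, (#(Numbering.prefixed x) : ℝ) * a x := by
  simp_rw [sum_filter]
  rw [sum_comm]
  refine sum_congr rfl fun x _ => ?_
  rw [← sum_filter, sum_const, nsmul_eq_mul]
  rfl

lemma isChain_isPrefix (f : Numbering (Fin n)) :
    IsChain (· ⊆ ·) {x : Finset (Fin n) | f.IsPrefix x} := by
  intro x hx y hy _
  rcases le_total #x #y with h | h
  · exact Or.inl (hx.subset_of_card_le_card hy h)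
  · exact Or.inr (hy.subset_of_card_le_card hx h)

lemma exists_last_of_isPrefix {f : Numbering (Fin n)} {x z : Finset (Fin n)}
    (hx : f.IsPrefix x) (hz : f.IsPrefix z) (hxz : x < z) :
    ∃ a ∈ z, (f a : ℕ) + 1 = #z ∧ x ⊆ z.erase a := by
  have hlt : #x < #z := card_lt_card hxz
  have hzn : #z ≤ Fintype.card (Fin n) := card_le_univ z
  -- Positions start at 0, so the last element of the prefix `z` has position `#z - 1`.
  let k : Fin (Fintype.card (Fin n)) := ⟨#z - 1, by omega⟩
  have hk : ((f (f.symm k) : Fin _) : ℕ) = #z - 1 := by simp [k]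
  refine ⟨f.symm k, (hz _).2 (by omega), by omega, fun y hy => mem_erase.2 ⟨?_, hxz.le hy⟩⟩
  rintro rfl
  have := (hx _).1 hy
  omega

/-- Among the numberings having `z` as a prefix, each element of `z` is equally often the last
one of `z`. -/
lemma card_prefixed_last_mul (z : Finset (Fin n)) {a : Fin n} (ha : a ∈ z) :
    #{f ∈ Numbering.prefixed z | ((f a : Fin _) : ℕ) + 1 = #z} * #z =
      #(Numbering.prefixed z) := by
  have hsymm : ∀ b ∈ z, #{f ∈ Numbering.prefixed z | ((f b : Fin _) : ℕ) + 1 = #z} =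
      #{f ∈ Numbering.prefixed z | ((f a : Fin _) : ℕ) + 1 = #z} := by
    intro b hb
    have hmaps : ∀ f : Numbering (Fin n), f.IsPrefix z →
        Numbering.IsPrefix ((Equiv.swap a b).trans f) z := by
      intro f hf y
      rw [Equiv.trans_apply, ← hf]
      rcases eq_or_ne y a with rfl | hya
      · simp [ha, hb]
      rcases eq_or_ne y b with rfl | hyb
      · simp [ha, hb]
      · rw [Equiv.swap_apply_of_ne_of_ne hya hyb]
    refine card_bij' (fun f _ => (Equiv.swap a b).trans f) (fun f _ => (Equiv.swap a b).trans f)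
      ?_ ?_ ?_ ?_
    · intro f hf
      simp only [mem_filter, Numbering.mem_prefixed] at hf ⊢
      exact ⟨hmaps f hf.1, by simpa using hf.2⟩
    · intro f hf
      simp only [mem_filter, Numbering.mem_prefixed] at hf ⊢
      exact ⟨hmaps f hf.1, by simpa using hf.2⟩
    · intro f _
      ext y
      simp
    · intro f _
      ext y
      simp
  have hunion : Numbering.prefixed z =
      z.biUnion fun b => {f ∈ Numbering.prefixed z | ((f b : Fin _) : ℕ) + 1 = #z} := by
    ext f
    simp only [mem_biUnion, mem_filter]
    refine ⟨fun hf => ?_, fun ⟨b, _, hf, _⟩ => hf⟩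
    have hpos : 0 < #z := card_pos.2 ⟨a, ha⟩
    have hzn : #z ≤ Fintype.card (Fin n) := card_le_univ z
    let k : Fin (Fintype.card (Fin n)) := ⟨#z - 1, by omega⟩
    have hk : ((f (f.symm k) : Fin _) : ℕ) = #z - 1 := by simp [k]
    exact ⟨f.symm k, (Numbering.mem_prefixed.1 hf _).2 (by omega), hf, by omega⟩
  conv_rhs => rw [hunion]
  rw [card_biUnion, sum_congr rfl hsymm, sum_const, smul_eq_mul, mul_comm]
  intro b _ b' _ hbb'
  rw [Function.onFun, disjoint_left]
  intro f hf hf'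
  simp only [mem_filter] at hf hf'
  exact hbb' (f.injective (Fin.ext (by omega)))

/-- The LYM weight: a random maximal chain meets `x` with probability one over the size of its
layer, and the middle layer is the largest. -/
lemma factorial_le_card_prefixed_mul_choose (x : Finset (Fin n)) :
    n.factorial ≤ #(Numbering.prefixed x) * n.choose (n / 2) := by
  rw [Numbering.card_prefixed, Fintype.card_fin]
  have hx : #x ≤ n := by simpa using card_le_univ x
  calc n.factorial = n.choose #x * (#x).factorial * (n - #x).factorial :=
        (Nat.choose_mul_factorial_mul_factorial hx).symm
    _ = (#x).factorial * (n - #x).factorial * n.choose #x := by ring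
    _ ≤ _ := Nat.mul_le_mul_left _ (Nat.choose_le_middle _ _)

end Numbering

/-! ### Containers and their weight -/

section Container

variable {n m : ℕ} {G : Finset (List (Fin m))}

/-- All suffixes of members of `G`. -/
def suffixes (G : Finset (List (Fin m))) : Finset (List (Fin m)) :=
  G.biUnion fun g => g.tails.toFinset

lemma mem_suffixes {p : List (Fin m)} : p ∈ suffixes G ↔ ∃ g ∈ G, p <:+ g := by
  simp [suffixes]

lemma mem_suffixes_of_mem {g : List (Fin m)} (hg : g ∈ G) : g ∈ suffixes G :=
  mem_suffixes.2 ⟨g, hg, List.suffix_refl g⟩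

lemma mem_suffixes_of_cons_mem {i : Fin m} {p : List (Fin m)} (h : i :: p ∈ suffixes G) :
    p ∈ suffixes G := by
  obtain ⟨g, hg, hp⟩ := mem_suffixes.1 h
  exact mem_suffixes.2 ⟨g, hg, (List.suffix_cons i p).trans hp⟩

open Classical in
/-- The elements `a` of `x` for which giving `x` the color `i` creates a new suffix
above `x.erase a`. -/
noncomputable def newBelow (G : Finset (List (Fin m))) (R : Finset (Fin n) → Fin m → Prop)
    (x : Finset (Fin n)) (i : Fin m) : Finset (Fin n) :=
  {a ∈ x | ∃ p, i :: p ∈ suffixes G ∧ ReachAbove R p x ∧ ¬ ReachAbove R (i :: p) (x.erase a)}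

open Classical in
/-- The template of colors that complete no member of `G` and create few new suffixes. -/
noncomputable def container (G : Finset (List (Fin m))) (δ : ℝ)
    (R : Finset (Fin n) → Fin m → Prop) : Template n m := fun x =>
  {i | (#(newBelow G R x i) : ℝ) ≤ δ * #x ∧ ∀ p, i :: p ∈ G → ¬ ReachAbove R p x}

/-- The color set of `z` in `T` creates a suffix that is not yet present above `x`. -/
def Creates (G : Finset (List (Fin m))) (R : Finset (Fin n) → Fin m → Prop) (T : Template n m)
    (z x : Finset (Fin n)) : Prop :=
  ∃ i ∈ T z, ∃ p, i :: p ∈ suffixes G ∧ ReachAbove R p z ∧ ¬ ReachAbove R (i :: p) x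

/-- If no member of `B` creates a suffix for a smaller one, every suffix visible through the
container restricted to `B` is already visible in `R`. The container allows no color completing a
member of `G` over `R`, so this restriction is a valid chain template. -/
lemma sum_log_le_of_not_creates (hlen : ∀ g ∈ G, 2 ≤ g.length) (hG : IsSparse G) {δ : ℝ}
    {R : Finset (Fin n) → Fin m → Prop} {B : Finset (Finset (Fin n))}
    (hB : IsChain (· ⊆ ·) (B : Set (Finset (Fin n))))
    (hBR : ∀ z ∈ B, ∀ x ∈ B, x < z → ¬ Creates G R (container G δ R) z x) :
    ∑ x ∈ B, Real.log (1 + (#(container G δ R x) : ℝ)) ≤ omegaCrit G := by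
  set T := container G δ R with hTdef
  let T' : Template n m := fun x => if x ∈ B then T x else ∅
  have hT'B : ∀ {x i}, i ∈ T' x → x ∈ B ∧ i ∈ T x := by
    intro x i hi
    by_cases hx : x ∈ B
    · exact ⟨hx, by simpa [T', hx] using hi⟩
    · simp [T', hx] at hi
  have hω : T'.omega = ∑ x ∈ B, Real.log (1 + (#(T x) : ℝ)) := by
    rw [Template.omega, ← sum_subset (subset_univ B)]
    · exact sum_congr rfl fun x hx => by simp [T', hx]
    · intro x _ hx
      simp [T', hx]
  rw [← hω]
  refine (isGreatest_omegaCrit hlen hG).2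
    (mem_critWeights_of_occurs (A := (B : Set (Finset (Fin n)))) ?_ hB ?_)
  · have key : ∀ p ∈ suffixes G, ∀ x ∈ B, ReachAbove (fun x i => i ∈ T' x) p x →
        ReachAbove R p x := by
      intro p
      induction p with
      | nil => intros; trivial
      | cons i p ih =>
        rintro hp x hx ⟨z, hxz, hz, h⟩
        obtain ⟨hzB, hzT⟩ := hT'B hz
        by_contra hcon
        exact hBR z hzB x hx hxz
          ⟨i, hzT, p, hp, ih (mem_suffixes_of_cons_mem hp) z hzB h, hcon⟩
    intro g hg hocc
    cases g with
    | nil => simpa using hlen _ hg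
    | cons i p =>
      obtain ⟨z, hz, h⟩ := (occurs_cons_iff _ _ _).1 hocc
      obtain ⟨hzB, hzT⟩ := hT'B hz
      have hp := key p (mem_suffixes_of_cons_mem (mem_suffixes_of_mem hg)) z hzB h
      simp only [hTdef, container, mem_filter] at hzT
      exact hzT.2.2 p hg hp
  · intro x hx
    have : x ∉ B := by simpa using hx
    simp [T', this]

open Classical in
/-- The members `z` of the chain of prefixes of `f` that create a suffix for a smaller member. -/
noncomputable def badPrefixes (G : Finset (List (Fin m))) (R : Finset (Fin n) → Fin m → Prop)
    (T : Template n m) (f : Numbering (Fin n)) : Finset (Finset (Fin n)) :=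
  {z | f.IsPrefix z ∧ ∃ x, f.IsPrefix x ∧ x < z ∧ Creates G R T z x}

lemma sum_log_isPrefix_le (hlen : ∀ g ∈ G, 2 ≤ g.length) (hG : IsSparse G) (δ : ℝ)
    (R : Finset (Fin n) → Fin m → Prop) (f : Numbering (Fin n)) :
    ∑ x with f.IsPrefix x, Real.log (1 + (#(container G δ R x) : ℝ)) ≤
      omegaCrit G * (1 + #(badPrefixes G R (container G δ R) f)) := by
  classical
  set T := container G δ R
  set D := badPrefixes G R T f with hD
  -- The pieces are the level sets of the number of bad prefixes strictly above. A bad `z` counts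
  -- for every `x < z` but not for itself, so it never shares a piece with a smaller set.
  let b : Finset (Fin n) → ℕ := fun x => #{z ∈ D | x < z}
  have hb : ∀ x ∈ ({x | f.IsPrefix x} : Finset (Finset (Fin n))), b x ∈ range (#D + 1) :=
    fun x _ => mem_range.2 (Nat.lt_succ_of_le (card_le_card (filter_subset _ _)))
  rw [← sum_fiberwise_of_maps_to hb]
  calc _ ≤ ∑ _v ∈ range (#D + 1), omegaCrit G := ?_
    _ = _ := by rw [sum_const, card_range, nsmul_eq_mul, mul_comm]; push_cast; ring
  refine sum_le_sum fun v _ => sum_log_le_of_not_creates hlen hG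
    ((isChain_isPrefix f).mono fun x hx => ?_) fun z hz x hx hxz hcr => ?_
  · simp only [coe_filter, mem_filter, mem_univ, true_and, Set.mem_ofPred_eq] at hx
    exact hx.1
  · simp only [mem_filter, mem_univ, true_and] at hz hx
    have hzD : z ∈ D := by
      simp only [hD, badPrefixes, mem_filter, mem_univ, true_and]
      exact ⟨hz.1, x, hx.1, hxz, hcr⟩
    have : b z < b x := by
      refine card_lt_card ⟨fun y hy => ?_, fun h => ?_⟩
      · rw [mem_filter] at hy ⊢
        exact ⟨hy.1, hxz.trans hy.2⟩
      · exact lt_irrefl z (mem_filter.1 (h (mem_filter.2 ⟨hzD, hxz⟩))).2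
    omega

/-- If `z` is bad for `f`, its last element `a` under `f` lies in `newBelow` for some allowed color:
a suffix not visible from `x ⊆ z.erase a` is not visible from `z.erase a`. Each allowed color has at
most `δ * #z` such `a`, and each is last for a fraction `1 / #z` of the numberings, so `z` is bad
for a fraction at most `m * δ` of them. -/
lemma sum_card_badPrefixes_le {δ : ℝ} (hδ : 0 ≤ δ) (R : Finset (Fin n) → Fin m → Prop) :
    ∑ f : Numbering (Fin n), (#(badPrefixes G R (container G δ R) f) : ℝ) ≤
      m * δ * ∑ x with container G δ R x ≠ ∅, (#(Numbering.prefixed x) : ℝ) := by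
  classical
  set T := container G δ R with hT
  have hswap : ∑ f : Numbering (Fin n), #(badPrefixes G R T f) =
      ∑ z, #{f : Numbering (Fin n) | z ∈ badPrefixes G R T f} := by
    simp_rw [card_eq_sum_ones, sum_filter]
    rw [sum_comm]
    refine sum_congr rfl fun f _ => ?_
    rw [← sum_filter]
    congr 1
    ext z
    simp
  rw [← Nat.cast_sum, hswap, Nat.cast_sum, sum_filter, mul_sum]
  refine sum_le_sum fun z _ => ?_
  have hsub : ({f : Numbering (Fin n) | z ∈ badPrefixes G R T f} : Finset _) ⊆
      (T z).biUnion fun i => (newBelow G R z i).biUnion fun a =>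
        {f ∈ Numbering.prefixed z | ((f a : Fin _) : ℕ) + 1 = #z} := by
    intro f hf
    simp only [badPrefixes, mem_filter, mem_univ, true_and] at hf
    obtain ⟨hfz, x, hfx, hxz, i, hi, p, hp, hpz, hpx⟩ := hf
    obtain ⟨a, haz, hfa, hxa⟩ := exists_last_of_isPrefix hfx hfz hxz
    simp only [mem_biUnion, mem_filter, Numbering.mem_prefixed, newBelow]
    exact ⟨i, hi, a, ⟨haz, p, hp, hpz, fun h => hpx (h.mono (fun _ _ => id) hxa)⟩, hfz, hfa⟩
  have hone : ∀ i ∈ T z, (#((newBelow G R z i).biUnion fun a =>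
      {f ∈ Numbering.prefixed z | ((f a : Fin _) : ℕ) + 1 = #z}) : ℝ) ≤
      δ * #(Numbering.prefixed z) := by
    intro i hi
    rcases z.eq_empty_or_nonempty with rfl | hz
    · have : newBelow G R ∅ i = ∅ := by simp [newBelow]
      rw [this]
      simp only [biUnion_empty, card_empty, Nat.cast_zero]
      positivity
    have hzpos : (0 : ℝ) < #z := by exact_mod_cast card_pos.2 hz
    have hi' : (#(newBelow G R z i) : ℝ) ≤ δ * #z := by
      simp only [hT, container, mem_filter] at hi
      exact hi.2.1
    refine le_of_mul_le_mul_right ?_ hzpos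
    calc _ ≤ ((∑ a ∈ newBelow G R z i,
          #{f ∈ Numbering.prefixed z | ((f a : Fin _) : ℕ) + 1 = #z} : ℕ) : ℝ) * #z := by
          gcongr
          exact card_biUnion_le
      _ = #(newBelow G R z i) * #(Numbering.prefixed z) := by
          have h : ∀ a ∈ newBelow G R z i,
              #{f ∈ Numbering.prefixed z | ((f a : Fin _) : ℕ) + 1 = #z} * #z =
                #(Numbering.prefixed z) :=
            fun a ha => card_prefixed_last_mul z (mem_filter.1 ha).1
          rw [← Nat.cast_mul, sum_mul, sum_congr rfl h]
          simp
      _ ≤ δ * #z * #(Numbering.prefixed z) := by gcongr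
      _ = _ := by ring
  by_cases hTz : T z = ∅
  · have : #{f : Numbering (Fin n) | z ∈ badPrefixes G R T f} = 0 := by
      rw [card_eq_zero, ← subset_empty]
      simpa [hTz] using hsub
    simp [this, hTz]
  · simp only [ne_eq, hTz, not_false_eq_true, if_true]
    calc (#{f : Numbering (Fin n) | z ∈ badPrefixes G R T f} : ℝ)
        ≤ ((∑ i ∈ T z, #((newBelow G R z i).biUnion fun a =>
          {f ∈ Numbering.prefixed z | ((f a : Fin _) : ℕ) + 1 = #z}) : ℕ) : ℝ) := by
          exact_mod_cast (card_le_card hsub).trans card_biUnion_le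
      _ ≤ ∑ _i ∈ T z, δ * #(Numbering.prefixed z) := by
          rw [Nat.cast_sum]
          exact sum_le_sum hone
      _ ≤ m * δ * #(Numbering.prefixed z) := by
          rw [sum_const, nsmul_eq_mul, mul_assoc]
          gcongr
          simpa using card_le_univ (T z)

lemma omegaCrit_nonneg (hlen : ∀ g ∈ G, 2 ≤ g.length) (hG : IsSparse G) : 0 ≤ omegaCrit G :=
  (Real.log_nonneg (by simp)).trans
    ((isGreatest_omegaCrit hlen hG).2 (log_one_add_mem_critWeights hlen))

lemma omega_container_mul_le (hlen : ∀ g ∈ G, 2 ≤ g.length) (hG : IsSparse G) {δ : ℝ}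
    (hδ : 0 ≤ δ) (hδ1 : omegaCrit G * m / Real.log 2 * δ ≤ 1)
    (R : Finset (Fin n) → Fin m → Prop) :
    (container G δ R).omega * (1 - omegaCrit G * m / Real.log 2 * δ) ≤
      omegaCrit G * n.choose (n / 2) := by
  set T := container G δ R with hT
  set κ := omegaCrit G * m / Real.log 2 * δ with hκ
  have hω := omegaCrit_nonneg hlen hG
  have hlog2 : 0 < Real.log 2 := Real.log_pos (by norm_num)
  set S : ℝ := ∑ x, (#(Numbering.prefixed x) : ℝ) * Real.log (1 + (#(T x) : ℝ)) with hS
  -- Each support element contributes at least log 2, so the number of cuts is controlled by `S`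
  -- itself and the bound on `S` closes up.
  have hsupp : ∑ x with T x ≠ ∅, (#(Numbering.prefixed x) : ℝ) ≤ S / Real.log 2 := by
    rw [le_div_iff₀ hlog2, sum_mul, hS, sum_filter]
    refine sum_le_sum fun x _ => ?_
    split_ifs with h
    · have : (1 : ℝ) ≤ #(T x) := by
        exact_mod_cast card_pos.2 (nonempty_iff_ne_empty.2 h)
      gcongr
      linarith
    · exact mul_nonneg (Nat.cast_nonneg _) (Real.log_nonneg (by simp))
  have hSle : S ≤ omegaCrit G * n.factorial + κ * S := by
    calc S = ∑ f : Numbering (Fin n), ∑ x with f.IsPrefix x, Real.log (1 + (#(T x) : ℝ)) :=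
          (sum_sum_isPrefix _).symm
      _ ≤ ∑ f : Numbering (Fin n), omegaCrit G * (1 + #(badPrefixes G R T f)) :=
          sum_le_sum fun f _ => sum_log_isPrefix_le hlen hG δ R f
      _ = omegaCrit G * (n.factorial + ∑ f : Numbering (Fin n), (#(badPrefixes G R T f) : ℝ)) := by
          rw [← mul_sum, sum_add_distrib]
          simp
      _ ≤ omegaCrit G * (n.factorial + m * δ * (S / Real.log 2)) := by
          gcongr
          exact (sum_card_badPrefixes_le hδ R).trans (by gcongr)
      _ = _ := by rw [hκ]; ring
  have hωS : T.omega * n.factorial ≤ S * n.choose (n / 2) := by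
    rw [Template.omega, sum_mul, hS, sum_mul]
    refine sum_le_sum fun x _ => ?_
    have h : (n.factorial : ℝ) ≤ #(Numbering.prefixed x) * n.choose (n / 2) := by
      exact_mod_cast factorial_le_card_prefixed_mul_choose x
    have h0 : 0 ≤ Real.log (1 + (#(T x) : ℝ)) := Real.log_nonneg (by simp)
    nlinarith [mul_le_mul_of_nonneg_left h h0]
  have hfac : (0 : ℝ) < n.factorial := by exact_mod_cast n.factorial_pos
  refine le_of_mul_le_mul_right ?_ hfac
  calc T.omega * (1 - κ) * n.factorial = T.omega * n.factorial * (1 - κ) := by ring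
    _ ≤ S * n.choose (n / 2) * (1 - κ) :=
        mul_le_mul_of_nonneg_right hωS (by linarith)
    _ = S * (1 - κ) * n.choose (n / 2) := by ring
    _ ≤ omegaCrit G * n.factorial * n.choose (n / 2) :=
        mul_le_mul_of_nonneg_right (by linarith) (Nat.cast_nonneg _)
    _ = _ := by ring

end Container

/-! ### Fingerprints and the number of containers -/

section Fingerprint

variable {n m : ℕ} {G : Finset (List (Fin m))}

/-- The elements of the underlying set of a colored subset. -/
def coloredSet (c : ColoredSubset (Finset (Fin n)) m) : Finset (Finset (Fin n)) :=
  {x | c x ≠ none}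

open Classical in
/-- The weighted number of pairs of a set `y` and a suffix that occurs above `y`. -/
noncomputable def potential (G : Finset (List (Fin m))) (c : ColoredSubset (Finset (Fin n)) m) :
    ℝ :=
  ∑ y : Finset (Fin n),
    (#{p ∈ suffixes G | ReachAbove (fun x i => c x = some i) p y} : ℝ) / (#y + 1)

lemma potential_nonneg (G : Finset (List (Fin m))) (c : ColoredSubset (Finset (Fin n)) m) :
    0 ≤ potential G c :=
  sum_nonneg fun _ _ => by positivity

/-- Coloring `x` makes a new suffix visible from `x.erase a` for each `a` in `newBelow`. These sets
are distinct and have size `#x - 1`, so each adds at least `1 / #x`; this is why the potential has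
weights `1 / (#y + 1)`. -/
lemma potential_add_le (G : Finset (List (Fin m))) {c : ColoredSubset (Finset (Fin n)) m}
    {x : Finset (Fin n)} (hx : c x = none) (i : Fin m) :
    potential G c * #x + #(newBelow G (fun x i => c x = some i) x i) ≤
      potential G (Function.update c x (some i)) * #x := by
  classical
  set c' := Function.update c x (some i) with hc'
  have hcc' : ∀ y j, c y = some j → c' y = some j := by
    intro y j hy
    have : y ≠ x := by rintro rfl; simp [hx] at hy
    rw [hc', Function.update_of_ne this, hy]
  set V := newBelow G (fun x i => c x = some i) x i with hV
  have hmono : ∀ y, ({p ∈ suffixes G | ReachAbove (fun x i => c x = some i) p y} : Finset _) ⊆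
      {p ∈ suffixes G | ReachAbove (fun x i => c' x = some i) p y} := by
    intro y p hp
    rw [mem_filter] at hp ⊢
    exact ⟨hp.1, hp.2.mono hcc' le_rfl⟩
  have hcardV : (#V : ℝ) = ∑ y ∈ V.image x.erase, (1 : ℝ) := by
    rw [sum_const, nsmul_eq_mul, mul_one, card_image_of_injOn]
    intro a ha b hb hab
    have ha' : a ∈ x := (mem_filter.1 ha).1
    have hb' : b ∈ x := (mem_filter.1 hb).1
    exact erase_injOn x ha' hb' hab
  rw [hcardV, sum_subset_zero_on_sdiff (subset_univ _)
    (g := fun y => if y ∈ V.image x.erase then (1 : ℝ) else 0)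
    (fun y hy => by simp only [mem_sdiff, mem_univ, true_and] at hy; simp [hy])
    (fun y hy => by simp [hy]), potential, potential, sum_mul, sum_mul, ← sum_add_distrib]
  refine sum_le_sum fun y _ => ?_
  have hle := card_le_card (hmono y)
  split_ifs with hy
  · obtain ⟨a, ha, rfl⟩ := mem_image.1 hy
    obtain ⟨hax, p, hp, hpx, hpa⟩ := mem_filter.1 ha
    have hlt := card_lt_card (s := {p ∈ suffixes G |
      ReachAbove (fun x i => c x = some i) p (x.erase a)}) (t := {p ∈ suffixes G |
      ReachAbove (fun x i => c' x = some i) p (x.erase a)}) ⟨hmono _, fun h => hpa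
        (mem_filter.1 (h (mem_filter.2 ⟨hp, x, erase_ssubset hax, by simp [hc'],
          hpx.mono hcc' le_rfl⟩))).2⟩
    have hcard : ((#(x.erase a) : ℕ) : ℝ) + 1 = #x := by
      exact_mod_cast card_erase_add_one hax
    have hpos : (0 : ℝ) < #x := by exact_mod_cast card_pos.2 ⟨a, hax⟩
    rw [hcard, div_mul_cancel₀ _ hpos.ne', div_mul_cancel₀ _ hpos.ne']
    exact_mod_cast hlt
  · rw [add_zero]
    gcongr

lemma exists_fingerprint {c : ColoredSubset (Finset (Fin n)) m} (hc : IsValid G c) {δ : ℝ}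
    (hδ : 0 ≤ δ) : ∃ F : ColoredSubset (Finset (Fin n)) m,
      δ * #(coloredSet F) ≤ potential G F ∧
      ∀ x i, c x = some i → i ∈ container G δ (fun x i => F x = some i) x := by
  classical
  -- If some `x` of `c` had more than `δ * #x` new suffix positions, adding it to `F` would gain
  -- more than `δ` and contradict maximality.
  let 𝓕 : Finset (ColoredSubset (Finset (Fin n)) m) :=
    {F | (∀ x i, F x = some i → c x = some i) ∧ δ * #(coloredSet F) ≤ potential G F}
  have hne : 𝓕.Nonempty := ⟨fun _ => none, by
    simp only [𝓕, mem_filter, mem_univ, true_and]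
    exact ⟨by simp, by simpa [coloredSet] using potential_nonneg G _⟩⟩
  obtain ⟨F, hF, hmax⟩ := exists_max_image 𝓕 (fun F => #(coloredSet F)) hne
  simp only [𝓕, mem_filter, mem_univ, true_and] at hF hmax
  refine ⟨F, hF.2, fun x i hxi => ?_⟩
  simp only [container, mem_filter, mem_univ, true_and]
  refine ⟨?_, fun p hp h => hc _ hp ?_⟩
  · by_contra! hlt
    have hFx : F x = none := by
      by_contra hne
      obtain ⟨j, hj⟩ := Option.ne_none_iff_exists'.1 hne
      have hji : j = i := by
        have := hF.1 x j hj
        rw [hxi] at this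
        exact (Option.some.inj this).symm
      -- A set already colored in `F` is itself the witness that `i :: p` is visible from below it.
      have : newBelow G (fun x i => F x = some i) x i = ∅ := by
        rw [newBelow, filter_eq_empty_iff]
        rintro a ha ⟨p, -, hp, hpa⟩
        exact hpa ⟨x, erase_ssubset ha, hji ▸ hj, hp⟩
      rw [this, card_empty, Nat.cast_zero] at hlt
      exact absurd hlt (not_lt.2 (by positivity))
    have hset : coloredSet (Function.update F x (some i)) = insert x (coloredSet F) := by
      ext y
      rcases eq_or_ne y x with rfl | hyx
      · simp [coloredSet]
      · simp [coloredSet, hyx]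
    have hcard : #(coloredSet (Function.update F x (some i))) = #(coloredSet F) + 1 := by
      rw [hset, card_insert_of_notMem (by simp [coloredSet, hFx])]
    have hpot := potential_add_le G hFx i
    have hxpos : (0 : ℝ) < #x := by
      rcases x.eq_empty_or_nonempty with rfl | h
      · simp [newBelow] at hlt
      · exact_mod_cast card_pos.2 h
    have hgain : potential G F + δ ≤ potential G (Function.update F x (some i)) := by
      refine le_of_mul_le_mul_right ?_ hxpos
      linarith
    have := hmax (Function.update F x (some i)) ⟨fun y j hy => ?_, ?_⟩
    · omega
    · rcases eq_or_ne y x with rfl | hyx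
      · rw [Function.update_self] at hy
        rw [hxi, hy]
      · rw [Function.update_of_ne hyx] at hy
        exact hF.1 y j hy
    · rw [hcard]
      push_cast
      linarith [hF.2]
  · exact (occurs_cons_iff (fun x i => c x = some i) i p).2 ⟨x, hxi, h.mono hF.1 le_rfl⟩

lemma sum_one_div_card_add_one_le (n : ℕ) :
    ∑ y : Finset (Fin n), (1 : ℝ) / (#y + 1) ≤ 2 ^ (n + 1) / (n + 1) := by
  have h1 : ∑ y : Finset (Fin n), (1 : ℝ) / (#y + 1) =
      ∑ k ∈ range (n + 1), (n.choose k : ℝ) * (1 / (k + 1)) := by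
    have := sum_powerset_apply_card (fun k : ℕ => (1 : ℝ) / (k + 1)) (x := (univ : Finset (Fin n)))
    simpa [nsmul_eq_mul] using this
  have h2 : ∀ k ∈ range (n + 1), (n.choose k : ℝ) * (1 / (k + 1)) =
      ((n + 1).choose (k + 1) : ℝ) / (n + 1) := by
    intro k _
    have : ((n + 1 : ℕ) : ℝ) * n.choose k = (n + 1).choose (k + 1) * ((k + 1 : ℕ) : ℝ) := by
      exact_mod_cast Nat.add_one_mul_choose_eq n k
    push_cast at this
    field_simp
    linarith
  rw [h1, sum_congr rfl h2, ← sum_div]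
  gcongr
  have h3 := Nat.sum_range_choose (n + 1)
  rw [sum_range_succ'] at h3
  have : ∑ k ∈ range (n + 1), (n + 1).choose (k + 1) ≤ 2 ^ (n + 1) := by omega
  exact_mod_cast this

lemma potential_le (G : Finset (List (Fin m))) (c : ColoredSubset (Finset (Fin n)) m) :
    potential G c ≤ #(suffixes G) * (2 ^ (n + 1) / (n + 1)) := by
  classical
  calc potential G c ≤ ∑ y : Finset (Fin n), #(suffixes G) * ((1 : ℝ) / (#y + 1)) := by
        refine sum_le_sum fun y _ => ?_
        rw [mul_one_div]
        gcongr
        exact filter_subset _ _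
    _ ≤ _ := by
        rw [← mul_sum]
        gcongr
        exact sum_one_div_card_add_one_le n

open Classical in
-- Exponential weighting: give each colored set weight `1 / n`. The total weight is `(1 + m / n) ^ 2
-- ^ n`, and each counted `F` weighs at least `exp (-N log n)`.
lemma card_coloredSet_le (hn : 1 ≤ n) (N : ℝ) :
    (#{F : ColoredSubset (Finset (Fin n)) m | (#(coloredSet F) : ℝ) ≤ N} : ℝ) ≤
      Real.exp (N * Real.log n + m * 2 ^ n / n) := by
  have hn0 : (0 : ℝ) < n := by exact_mod_cast hn
  have hlog : 0 ≤ Real.log n := Real.log_nonneg (by exact_mod_cast hn)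
  have hsum : ∑ F : ColoredSubset (Finset (Fin n)) m,
      ∏ x, (if F x = none then (1 : ℝ) else (n : ℝ)⁻¹) = (1 + m * (n : ℝ)⁻¹) ^ (2 ^ n) := by
    rw [← Fintype.prod_sum (fun (_ : Finset (Fin n)) (o : Option (Fin m)) =>
      if o = none then (1 : ℝ) else (n : ℝ)⁻¹)]
    simp [Fintype.sum_option]
  have hprod : ∀ F : ColoredSubset (Finset (Fin n)) m,
      ∏ x, (if F x = none then (1 : ℝ) else (n : ℝ)⁻¹) =
        Real.exp (-(#(coloredSet F) * Real.log n)) := by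
    intro F
    rw [prod_ite, prod_const_one, one_mul, prod_const, Real.exp_neg, Real.exp_nat_mul,
      Real.exp_log hn0, inv_pow]
    rfl
  have h1 : (#{F : ColoredSubset (Finset (Fin n)) m | (#(coloredSet F) : ℝ) ≤ N} : ℝ) *
      Real.exp (-(N * Real.log n)) ≤ Real.exp (m * 2 ^ n / n) := by
    calc _ = ∑ F : ColoredSubset (Finset (Fin n)) m with (#(coloredSet F) : ℝ) ≤ N,
          Real.exp (-(N * Real.log n)) := by rw [sum_const, nsmul_eq_mul]
      _ ≤ ∑ F : ColoredSubset (Finset (Fin n)) m with (#(coloredSet F) : ℝ) ≤ N,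
          Real.exp (-(#(coloredSet F) * Real.log n)) := by
          refine sum_le_sum fun F hF => ?_
          have := (mem_filter.1 hF).2
          gcongr
      _ ≤ ∑ F : ColoredSubset (Finset (Fin n)) m, Real.exp (-(#(coloredSet F) * Real.log n)) :=
          sum_le_sum_of_subset_of_nonneg (filter_subset _ _) fun _ _ _ => (Real.exp_pos _).le
      _ = (1 + m * (n : ℝ)⁻¹) ^ (2 ^ n) := by
          rw [← hsum]
          exact sum_congr rfl fun F _ => (hprod F).symm
      _ ≤ Real.exp (m * (n : ℝ)⁻¹) ^ (2 ^ n) := by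
          gcongr
          rw [add_comm]
          exact Real.add_one_le_exp _
      _ = _ := by
          rw [← Real.exp_nat_mul]
          congr 1
          push_cast
          ring
  rw [Real.exp_neg, ← div_eq_mul_inv, div_le_iff₀ (Real.exp_pos _), ← Real.exp_add] at h1
  rwa [add_comm]

lemma card_piFinset_insertNone (T : Template n m) :
    (#(Fintype.piFinset fun x => insertNone (T x)) : ℝ) = Real.exp T.omega := by
  rw [Fintype.card_piFinset, Template.omega, Real.exp_sum]
  push_cast
  refine prod_congr rfl fun x _ => ?_
  rw [Real.exp_log (by positivity), card_insertNone]
  push_cast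
  ring

lemma ncard_Lam_le (hlen : ∀ g ∈ G, 2 ≤ g.length) (hG : IsSparse G) {δ : ℝ} (hδ : 0 < δ)
    (hδ1 : omegaCrit G * m / Real.log 2 * δ < 1) (hn : 1 ≤ n) :
    ((Lam G n).ncard : ℝ) ≤ Real.exp
      (#(suffixes G) * (2 ^ (n + 1) / (n + 1)) / δ * Real.log n + m * 2 ^ n / n +
        omegaCrit G * n.choose (n / 2) / (1 - omegaCrit G * m / Real.log 2 * δ)) := by
  classical
  set N : ℝ := #(suffixes G) * (2 ^ (n + 1) / (n + 1)) / δ with hN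
  set small : Finset (ColoredSubset (Finset (Fin n)) m) :=
    {F | (#(coloredSet F) : ℝ) ≤ N} with hsmall
  have hsub : Lam G n ⊆ (small.biUnion fun F => Fintype.piFinset fun x =>
      insertNone (container G δ (fun x i => F x = some i) x) :
        Finset (ColoredSubset (Finset (Fin n)) m)) := by
    intro c hc
    obtain ⟨F, hF, hcF⟩ := exists_fingerprint (G := G) hc hδ.le
    rw [mem_coe, mem_biUnion]
    refine ⟨F, ?_, ?_⟩
    · rw [hsmall, mem_filter]
      refine ⟨mem_univ _, ?_⟩
      rw [hN, le_div_iff₀ hδ, mul_comm]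
      exact hF.trans (potential_le G F)
    · rw [Fintype.mem_piFinset]
      intro x
      rw [mem_insertNone]
      exact fun i hi => hcF x i hi
  have h1 : (Lam G n).ncard ≤ ∑ F ∈ small, #(Fintype.piFinset fun x =>
      insertNone (container G δ (fun x i => F x = some i) x)) := by
    refine (Set.ncard_le_ncard hsub (finite_toSet _)).trans ?_
    rw [Set.ncard_coe_finset]
    exact card_biUnion_le
  calc ((Lam G n).ncard : ℝ) ≤ ∑ F ∈ small, (#(Fintype.piFinset fun x =>
      insertNone (container G δ (fun x i => F x = some i) x)) : ℝ) := by exact_mod_cast h1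
    _ ≤ ∑ _F ∈ small, Real.exp (omegaCrit G * n.choose (n / 2) /
          (1 - omegaCrit G * m / Real.log 2 * δ)) := by
        refine sum_le_sum fun F _ => ?_
        rw [card_piFinset_insertNone, Real.exp_le_exp, le_div_iff₀ (by linarith)]
        exact omega_container_mul_le hlen hG hδ.le hδ1.le _
    _ ≤ _ := by
        rw [sum_const, nsmul_eq_mul, Real.exp_add]
        gcongr
        exact card_coloredSet_le hn N

end Fingerprint

/-! ### Lower bound from copied layers -/

section Layers

variable {r m : ℕ} {G : Finset (List (Fin m))}

/-- The colors that a template allows on some set of size `k`. -/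
def layerColors (T : Template r m) (k : ℕ) : Finset (Fin m) :=
  {i | ∃ x, #x = k ∧ i ∈ T x}

/-- The template on `n` points that copies the layers of `T` to the layers from the middle one
upwards. -/
def spread (T : Template r m) (n : ℕ) : Template n m := fun y =>
  if n / 2 ≤ #y then layerColors T (#y - n / 2) else ∅

lemma omega_le_sum_layerColors {T : Template r m} {A : Set (Finset (Fin r))}
    (hA : IsChain (· ⊆ ·) A) (hTA : T.SupportedOn A) :
    T.omega ≤ ∑ k ∈ range (r + 1), Real.log (1 + (#(layerColors T k) : ℝ)) := by
  rw [Template.omega, ← sum_fiberwise_of_maps_to (s := univ) (t := range (r + 1)) (g := card)]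
  · refine sum_le_sum fun k _ => ?_
    by_cases h : ∃ x : Finset (Fin r), #x = k ∧ T x ≠ ∅
    · obtain ⟨x, hx, hTx⟩ := h
      have hxA : ∀ y, T y ≠ ∅ → y ∈ A := fun y hy => by
        by_contra hyA
        exact hy (hTA y hyA)
      rw [sum_eq_single x]
      · gcongr
        intro i hi
        simp only [layerColors, mem_filter, mem_univ, true_and]
        exact ⟨x, hx, hi⟩
      · intro y hy hyx
        have hy' : #y = k := (mem_filter.1 hy).2
        have : T y = ∅ := by
          by_contra hTy
          exact hyx (isChain_eq_of_card_eq hA (hxA y hTy) (hxA x hTx) (hy'.trans hx.symm))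
        simp [this]
      · intro hx'
        simp [hx] at hx'
    · push Not at h
      rw [sum_eq_zero]
      · exact Real.log_nonneg (by simp)
      · intro y hy
        simp [h y (mem_filter.1 hy).2]
  · intro x _
    simpa [Nat.lt_succ_iff] using card_le_univ x

lemma sum_layerColors_le_omega_spread (T : Template r m) (n : ℕ) :
    ∑ k ∈ range (r + 1), Real.log (1 + (#(layerColors T k) : ℝ)) * n.choose (n / 2 + k) ≤
      (spread T n).omega := by
  have h1 : ∀ k, Real.log (1 + (#(layerColors T k) : ℝ)) * n.choose (n / 2 + k) =
      ∑ y : Finset (Fin n),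
        if #y = n / 2 + k then Real.log (1 + (#(layerColors T k) : ℝ)) else 0 := by
    intro k
    rw [← sum_filter, sum_const, nsmul_eq_mul, mul_comm]
    congr 2
    rw [univ_filter_card_eq, card_powersetCard, card_univ, Fintype.card_fin]
  rw [sum_congr rfl fun k _ => h1 k, sum_comm, Template.omega]
  refine sum_le_sum fun y _ => ?_
  by_cases hy : n / 2 ≤ #y
  · have h2 : ∀ k, #y = n / 2 + k ↔ #y - n / 2 = k := fun k => by omega
    simp only [h2, spread, if_pos hy, sum_ite_eq]
    split_ifs
    · exact le_rfl
    · exact Real.log_nonneg (by simp)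
  · rw [sum_eq_zero]
    · exact Real.log_nonneg (by simp)
    · intro k _
      rw [if_neg (by omega)]

/-- Each set of a forbidden chain in a coloring from the spread template has a counterpart in `A`
allowing its color, with size shifted down by `n / 2`. Sizes strictly increase and `A` is a chain,
so the counterparts form the same forbidden chain in `T`. -/
lemma exp_omega_spread_le_ncard_Lam {T : Template r m} {A : Set (Finset (Fin r))}
    (hT : T.Valid G) (hA : IsChain (· ⊆ ·) A) (hTA : T.SupportedOn A) (n : ℕ) :
    Real.exp (spread T n).omega ≤ (Lam G n).ncard := by
  rw [← card_piFinset_insertNone, ← Set.ncard_coe_finset]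
  refine Nat.cast_le.2 (Set.ncard_le_ncard (fun c hc => ?_) (Set.toFinite _))
  rintro g hg ⟨y, hy, hyc⟩
  rw [Template.valid_iff] at hT
  have hyT : ∀ j, ∃ x, #x + n / 2 = #(y j) ∧ g.get j ∈ T x := by
    intro j
    have h := mem_insertNone.1 (Fintype.mem_piFinset.1 hc (y j)) (g.get j) (hyc j)
    by_cases hle : n / 2 ≤ #(y j)
    · simp only [spread, if_pos hle, layerColors, mem_filter, mem_univ, true_and] at h
      obtain ⟨x, hx, hxT⟩ := h
      exact ⟨x, by omega, hxT⟩
    · simp [spread, if_neg hle] at h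
  choose x hx hxT using hyT
  have hxA : ∀ j, x j ∈ A := fun j => by
    by_contra h
    have := hxT j
    simp [hTA _ h] at this
  refine hT g hg ⟨x, fun a b hab => isChain_lt_of_card_lt hA (hxA a) (hxA b) ?_, hxT⟩
  have := card_lt_card (hy hab)
  have := hx a
  have := hx b
  omega

end Layers

/-! ### Binomial estimates and the limit -/

section Asymptotics

open Filter Topology

lemma four_pow_le_choose_half_sq (n : ℕ) :
    4 ^ n ≤ 4 * (2 * n + 1) * n.choose (n / 2) ^ 2 := by
  have hcentral : ∀ k : ℕ, 16 ^ k ≤ (4 * k + 1) * k.centralBinom ^ 2 := by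
    intro k
    induction k with
    | zero => simp
    | succ k ih =>
      have h := Nat.succ_mul_centralBinom_succ k
      refine le_of_mul_le_mul_left (a := (k + 1) ^ 2) ?_ (by positivity)
      calc (k + 1) ^ 2 * 16 ^ (k + 1) = 16 * (k + 1) ^ 2 * 16 ^ k := by ring
        _ ≤ 16 * (k + 1) ^ 2 * ((4 * k + 1) * k.centralBinom ^ 2) := by gcongr
        _ = 4 * (4 * (4 * k + 1) * (k + 1) ^ 2) * k.centralBinom ^ 2 := by ring
        -- After expansion the two polynomials in `k` differ by exactly 1.
        _ ≤ 4 * ((4 * k + 5) * (2 * k + 1) ^ 2) * k.centralBinom ^ 2 := by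
            gcongr 4 * ?_ * _
            nlinarith
        _ = (4 * (k + 1) + 1) * (2 * (2 * k + 1) * k.centralBinom) ^ 2 := by ring
        _ = (4 * (k + 1) + 1) * ((k + 1) * (k + 1).centralBinom) ^ 2 := by rw [h]
        _ = _ := by ring
  rcases Nat.even_or_odd' n with ⟨k, rfl | rfl⟩
  · have h := hcentral k
    rw [Nat.centralBinom] at h
    rw [Nat.mul_div_cancel_left k two_pos, pow_mul]
    calc (4 ^ 2) ^ k ≤ (4 * k + 1) * (2 * k).choose k ^ 2 := by simpa using h
      _ ≤ _ := by gcongr; omega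
  · have h := hcentral k
    have hk : (2 * k + 1) / 2 = k := by omega
    rw [Nat.centralBinom] at h
    rw [hk, pow_succ, pow_mul]
    calc (4 ^ 2) ^ k * 4 ≤ (4 * k + 1) * (2 * k).choose k ^ 2 * 4 := by gcongr; simpa using h
      _ = 4 * (4 * k + 1) * (2 * k).choose k ^ 2 := by ring
      _ ≤ _ := by
        gcongr 4 * ?_ * ?_ ^ 2
        · omega
        · exact Nat.choose_le_choose k (by omega)

lemma two_pow_le_sqrt_mul_choose {n : ℕ} (hn : 1 ≤ n) :
    (2 : ℝ) ^ n ≤ 4 * √n * n.choose (n / 2) := by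
  refine le_of_sq_le_sq ?_ (by positivity)
  have hn' : (1 : ℝ) ≤ n := by exact_mod_cast hn
  have h : (4 : ℝ) ^ n ≤ 4 * (2 * n + 1) * (n.choose (n / 2) : ℝ) ^ 2 := by
    exact_mod_cast four_pow_le_choose_half_sq n
  calc ((2 : ℝ) ^ n) ^ 2 = 4 ^ n := by rw [← pow_mul, mul_comm, pow_mul]; norm_num
    _ ≤ 4 * (2 * n + 1) * (n.choose (n / 2) : ℝ) ^ 2 := h
    _ ≤ 16 * n * (n.choose (n / 2) : ℝ) ^ 2 :=
        mul_le_mul_of_nonneg_right (by linarith) (sq_nonneg _)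
    _ = (4 * √n * n.choose (n / 2)) ^ 2 := by
        rw [mul_pow, mul_pow, Real.sq_sqrt (by linarith)]
        ring

lemma choose_half_pos (n : ℕ) : (0 : ℝ) < n.choose (n / 2) := by
  exact_mod_cast Nat.choose_pos (Nat.div_le_self n 2)

lemma tendsto_half_atTop : Tendsto (fun n : ℕ => ((n / 2 : ℕ) : ℝ)) atTop atTop :=
  tendsto_natCast_atTop_atTop.comp (Nat.tendsto_div_const_atTop two_ne_zero)

/-- Consecutive binomial coefficients a bounded distance from the middle have ratio tending to 1. -/
lemma tendsto_choose_half_add (k : ℕ) :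
    Tendsto (fun n : ℕ => (n.choose (n / 2 + k) : ℝ) / n.choose (n / 2)) atTop (𝓝 1) := by
  induction k with
  | zero =>
    refine tendsto_const_nhds.congr fun n => ?_
    rw [add_zero, div_self (choose_half_pos n).ne']
  | succ k ih =>
    have hq : Tendsto (fun n : ℕ => ((n - (n / 2 + k) : ℕ) : ℝ) / ((n / 2 : ℕ) + k + 1))
        atTop (𝓝 1) := by
      have hlow : Tendsto (fun n : ℕ => 1 - (2 * k + 1 : ℝ) / ((n / 2 : ℕ) + (k + 1))) atTop
          (𝓝 1) := by
        have := (tendsto_half_atTop.atTop_add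
          (tendsto_const_nhds (x := (k + 1 : ℝ)))).const_div_atTop (2 * k + 1 : ℝ)
        simpa using this.const_sub 1
      refine tendsto_of_tendsto_of_tendsto_of_le_of_le hlow tendsto_const_nhds
        (fun n => ?_) fun n => ?_
      · have h : ((n / 2 : ℕ) : ℝ) ≤ ((n - (n / 2 + k) : ℕ) : ℝ) + k := by
          exact_mod_cast (by omega : n / 2 ≤ n - (n / 2 + k) + k)
        have hpos : (0 : ℝ) < (n / 2 : ℕ) + k + 1 := by positivity
        rw [← add_assoc, sub_le_iff_le_add, ← add_div, le_div_iff₀ hpos]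
        linarith
      · have h : ((n - (n / 2 + k) : ℕ) : ℝ) ≤ (n / 2 : ℕ) + k + 1 := by
          exact_mod_cast (by omega : n - (n / 2 + k) ≤ n / 2 + k + 1)
        exact div_le_one_of_le₀ h (by positivity)
    have := ih.mul hq
    rw [one_mul] at this
    refine this.congr fun n => ?_
    have h : (n.choose (n / 2 + (k + 1)) : ℝ) * ((n / 2 : ℕ) + k + 1) =
        n.choose (n / 2 + k) * ((n - (n / 2 + k) : ℕ) : ℝ) := by
      exact_mod_cast Nat.choose_succ_right_eq n (n / 2 + k)
    have hpos : (0 : ℝ) < (n / 2 : ℕ) + k + 1 := by positivity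
    have := choose_half_pos n
    rw [div_mul_div_comm, ← h, mul_div_mul_right _ _ hpos.ne']

lemma tendsto_log_div_sqrt : Tendsto (fun n : ℕ => Real.log n / √n) atTop (𝓝 0) := by
  have h := (isLittleO_log_rpow_atTop (show (0 : ℝ) < 1 / 2 by norm_num)).tendsto_div_nhds_zero
  simp_rw [← Real.sqrt_eq_rpow] at h
  exact h.comp tendsto_natCast_atTop_atTop

lemma tendsto_const_div_sqrt (a : ℝ) : Tendsto (fun n : ℕ => a / √(n : ℝ)) atTop (𝓝 0) :=
  (Real.tendsto_sqrt_atTop.comp tendsto_natCast_atTop_atTop).const_div_atTop a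

variable {m : ℕ} {G : Finset (List (Fin m))}

lemma Lam_nonempty (hlen : ∀ g ∈ G, 2 ≤ g.length) (n : ℕ) : (Lam G n).Nonempty := by
  refine ⟨fun _ => none, ?_⟩
  rintro g hg ⟨x, -, hx⟩
  have := hlen g hg
  cases hx ⟨0, by omega⟩

lemma ncard_Lam_pos (hlen : ∀ g ∈ G, 2 ≤ g.length) (n : ℕ) : 0 < (Lam G n).ncard :=
  (Set.ncard_pos (Set.toFinite _)).2 (Lam_nonempty hlen n)

lemma log_ncard_Lam_div_le (hlen : ∀ g ∈ G, 2 ≤ g.length) (hG : IsSparse G) {δ : ℝ} (hδ : 0 < δ)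
    (hδ1 : omegaCrit G * m / Real.log 2 * δ < 1) {n : ℕ} (hn : 1 ≤ n) :
    Real.log (Lam G n).ncard / n.choose (n / 2) ≤
      8 * #(suffixes G) / δ * (Real.log n / √n) + 4 * m / √n +
        omegaCrit G / (1 - omegaCrit G * m / Real.log 2 * δ) := by
  have hn0 : (0 : ℝ) < n := by exact_mod_cast hn
  have hs : 0 < √(n : ℝ) := Real.sqrt_pos.2 hn0
  have hss : √(n : ℝ) * √n = n := Real.mul_self_sqrt hn0.le
  have hlog : 0 ≤ Real.log n := Real.log_nonneg (by exact_mod_cast hn)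
  have hN : (0 : ℝ) < (Lam G n).ncard := by exact_mod_cast ncard_Lam_pos hlen n
  have hpow : (2 : ℝ) ^ n / n ≤ 4 / √n * n.choose (n / 2) := by
    rw [div_le_iff₀ hn0]
    refine (two_pow_le_sqrt_mul_choose hn).trans_eq ?_
    rw [div_mul_eq_mul_div, div_mul_eq_mul_div, eq_div_iff hs.ne']
    calc _ = 4 * n.choose (n / 2) * (√n * √n) := by ring
      _ = _ := by rw [hss]
  rw [div_le_iff₀ (choose_half_pos n)]
  refine ((Real.log_le_iff_le_exp hN).2 (ncard_Lam_le hlen hG hδ hδ1 hn)).trans ?_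
  have h1 : (#(suffixes G) : ℝ) * (2 ^ (n + 1) / (n + 1)) / δ * Real.log n ≤
      8 * #(suffixes G) / δ * (Real.log n / √n) * n.choose (n / 2) := by
    calc _ ≤ (#(suffixes G) : ℝ) * (2 ^ (n + 1) / n) / δ * Real.log n := by
          gcongr
          linarith
      _ = 2 * #(suffixes G) / δ * Real.log n * (2 ^ n / n) := by ring
      _ ≤ 2 * #(suffixes G) / δ * Real.log n * (4 / √n * n.choose (n / 2)) := by gcongr
      _ = _ := by ring
  have h2 : (m : ℝ) * 2 ^ n / n ≤ 4 * m / √n * n.choose (n / 2) := by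
    calc (m : ℝ) * 2 ^ n / n = m * (2 ^ n / n) := by ring
      _ ≤ m * (4 / √n * n.choose (n / 2)) := by gcongr
      _ = _ := by ring
  have h3 : omegaCrit G * n.choose (n / 2) / (1 - omegaCrit G * m / Real.log 2 * δ) =
      omegaCrit G / (1 - omegaCrit G * m / Real.log 2 * δ) * n.choose (n / 2) := by ring
  linarith

lemma tendsto_log_ncard_Lam (hlen : ∀ g ∈ G, 2 ≤ g.length) (hG : IsSparse G) :
    Tendsto (fun n : ℕ => Real.log (Lam G n).ncard / n.choose (n / 2)) atTop
      (𝓝 (omegaCrit G)) := by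
  rw [tendsto_order]
  constructor
  · intro a ha
    obtain ⟨r, T, A, hT, hA, hTA, hω⟩ := (isGreatest_omegaCrit hlen hG).1
    have hlim : Tendsto (fun n : ℕ => ∑ k ∈ range (r + 1),
        Real.log (1 + (#(layerColors T k) : ℝ)) *
          ((n.choose (n / 2 + k) : ℝ) / n.choose (n / 2))) atTop
        (𝓝 (∑ k ∈ range (r + 1), Real.log (1 + (#(layerColors T k) : ℝ)) * 1)) :=
      tendsto_finsetSum _ fun k _ => (tendsto_choose_half_add k).const_mul _
    have ha' : a < ∑ k ∈ range (r + 1), Real.log (1 + (#(layerColors T k) : ℝ)) * 1 := by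
      simp_rw [mul_one]
      exact ha.trans_le (hω.trans_le (omega_le_sum_layerColors hA hTA))
    filter_upwards [hlim.eventually_const_lt ha'] with n hn
    refine hn.trans_le ?_
    simp_rw [← mul_div_assoc]
    rw [← sum_div]
    gcongr
    refine (sum_layerColors_le_omega_spread T n).trans ?_
    rw [Real.le_log_iff_exp_le (by exact_mod_cast ncard_Lam_pos hlen n)]
    exact exp_omega_spread_le_ncard_Lam hT hA hTA n
  · intro a ha
    set κ := omegaCrit G * m / Real.log 2 with hκ
    have h1 : Tendsto (fun δ : ℝ => κ * δ) (𝓝[>] 0) (𝓝 0) := by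
      have : Tendsto (fun δ : ℝ => κ * δ) (𝓝 0) (𝓝 (κ * 0)) := tendsto_id.const_mul κ
      rw [mul_zero] at this
      exact this.mono_left nhdsWithin_le_nhds
    have h2 : Tendsto (fun δ : ℝ => omegaCrit G / (1 - κ * δ)) (𝓝[>] 0) (𝓝 (omegaCrit G)) := by
      have := (h1.const_sub 1).inv₀ (by norm_num) |>.const_mul (omegaCrit G)
      simpa [div_eq_mul_inv] using this
    obtain ⟨δ, ⟨hδ1, hδ2⟩, hδ⟩ := ((h1.eventually_lt_const one_pos).and
      (h2.eventually_lt_const ha)).and (self_mem_nhdsWithin) |>.exists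
    have h3 : Tendsto (fun n : ℕ => 8 * #(suffixes G) / δ * (Real.log n / √n) + 4 * m / √n +
        omegaCrit G / (1 - κ * δ)) atTop (𝓝 (omegaCrit G / (1 - κ * δ))) := by
      have := ((tendsto_log_div_sqrt.const_mul (8 * #(suffixes G) / δ)).add
        (tendsto_const_div_sqrt (4 * m))).add_const (omegaCrit G / (1 - κ * δ))
      simpa using this
    filter_upwards [h3.eventually_lt_const hδ2, eventually_ge_atTop 1] with n hn hn1
    exact (log_ncard_Lam_div_le hlen hG hδ hδ1 hn1).trans_lt hn

end Asymptotics

end ColoredChains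

theorem mainTheorem2 (m : ℕ) (G : Finset (List (Fin m)))
    (hlen : ∀ g ∈ G, 2 ≤ g.length) (hG : ColoredChains.IsSparse G) :
    IsGreatest (ColoredChains.critWeights G) (ColoredChains.omegaCrit G) ∧
    ∃ ε : ℕ → ℝ, Filter.Tendsto ε Filter.atTop (nhds 0) ∧
      ∀ n : ℕ, ((ColoredChains.Lam G n).ncard : ℝ) =
        Real.exp (ColoredChains.omegaCrit G * (n.choose (n / 2) : ℝ) * (1 + ε n)) := by
  open ColoredChains in
  refine ⟨isGreatest_omegaCrit hlen hG, ?_⟩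
  -- The error term is obtained by dividing by `omegaCrit G`. It vanishes only without colors, and
  -- then the empty colored subset is the only one.
  by_cases hω : omegaCrit G = 0
  · refine ⟨0, tendsto_const_nhds, fun n => ?_⟩
    have hm : m = 0 := by
      by_contra hm
      have hle := (isGreatest_omegaCrit hlen hG).2 (log_one_add_mem_critWeights hlen)
      have hpos : 0 < Real.log (1 + m) := Real.log_pos (by
        have : (0 : ℝ) < m := by exact_mod_cast Nat.pos_of_ne_zero hm
        linarith)
      linarith
    subst hm
    have : (Lam G n).ncard = 1 :=
      le_antisymm ((Set.ncard_le_one (Set.toFinite _)).2 fun _ _ _ _ => Subsingleton.elim _ _)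
        (ncard_Lam_pos hlen n)
    simp [this, hω]
  · refine ⟨fun n => Real.log (Lam G n).ncard / n.choose (n / 2) / omegaCrit G - 1, ?_, fun n => ?_⟩
    · have := ((tendsto_log_ncard_Lam hlen hG).div_const (omegaCrit G)).sub_const 1
      rwa [div_self hω, sub_self] at this
    · have hc := (choose_half_pos n).ne'
      have hN : (0 : ℝ) < (Lam G n).ncard := by exact_mod_cast ncard_Lam_pos hlen n
      rw [add_sub_cancel]
      field_simp
      rw [Real.exp_log hN]
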